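/- All spaces (in particular all images of $X$ considered below) are Tychonoff. Let $X$ be a Tychonoff space all of whose finite powers are Lindelöf, and let $n\ge 1$ be an integer. Then the following statements are equivalent: 1. $C_p(X)$ is strongly sequentially separable; 2. $C_p(X^n)$ is strongly sequentially separable; 3. $(C_p(X))^{\aleph_0}$ is strongly sequentially separable; 4. $C_p(X)$ is separable and Fréchet–Urysohn; 5. $C_p(X^n)$ is separable and Fréchet–Urysohn; 6. $(C_p(X))^{\aleph_0}$ is separable and Fréchet–Urysohn; 7. $iw(X)=\aleph_0$ and $X$ is projectively $S_1(\Omega,\Gamma)$; 8. $iw(X)=\aleph_0$ and $X^n$ is projectively $S_1(\Omega,\Gamma)$; 9. $iw(X)=\aleph_0$ and $X$ satisfies $S_1(\Omega,\Gamma)$; 10. $iw(X^n)=\aleph_0$ and $X^n$ satisfies $S_1(\Omega,\Gamma)$; 11. $iw(X)=\aleph_0$ and $X$ has property $\gamma$; 12. $iw(X^n)=\aleph_0$ and $X^n$ has property $\gamma$; 13. $C_p(X,\mathbb R^{\aleph_0})$ is separable and Fréchet–Urysohn; 14. $C_p(X,\mathbb R^{\aleph_0})$ is strongly sequentially separable.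 Here $C_p(Z,Y)$ is the set of continuous maps $Z\to Y$ with the topology of pointwise convergence, and $C_p(Z)=C_p(Z,\mathbb R)$. A space $S$ is strongly sequentially separable if it is separable and, for every countable dense $D\subseteq S$, each point of $S$ is the limit of a sequence of points of $D$. The $i$-weight $iw(Z)$ is the least infinite cardinal $\tau$ such that $Z$ admits a one-to-one continuous map onto a space of weight at most $\tau$. An $\omega$-cover of $Z$ is an open cover $\mathcal U$ of $Z$ with $Z\notin\mathcal U$ such that every finite subset of $Z$ is contained in a member of $\mathcal U$; a $\gamma$-cover is an infinite open cover such that each point belongs to all but finitely many of its members. $Z$ satisfies $S_1(\Omega,\Gamma)$ if for each sequence $(\mathcal U_k)_{k\in\omega}$ of $\omega$-covers there are $U_k\in\mathcal U_k$ such that $\{U_k : k\in\omega\}$ is a $\gamma$-cover; $Z$ is projectively $S_1(\Omega,\Gamma)$ if every second countable continuous image of $Z$ satisfies $S_1(\Omega,\Gamma)$; $Z$ has property $\gamma$ if every $\omega$-cover of $Z$ contains a countable subfamily that is a $\gamma$-cover. -/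

import Mathlib

open Set Filter Topology
open scoped Cardinal

universe u v

/-- `Cp X Y`: the continuous maps `X → Y` with the topology of pointwise convergence, that is,
with the subspace topology inherited from the product `X → Y`. -/
abbrev Cp (X : Type u) (Y : Type v) [TopologicalSpace X] [TopologicalSpace Y] : Type (max u v) :=
  {f : X → Y // Continuous f}

/-- `S` is strongly sequentially separable: it is separable and every countable dense subset `D` is
sequentially dense, i.e. every point of `S` is the limit of a sequence of points of `D`. -/
def StronglySequentiallySeparable (S : Type u) [TopologicalSpace S] : Prop :=
  TopologicalSpace.SeparableSpace S ∧
    ∀ D : Set S, D.Countable → Dense D → seqClosure D = univ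

/-- The weight of a space: the least cardinality of a base. -/
noncomputable def topWeight (Y : Type u) [TopologicalSpace Y] : Cardinal.{u} :=
  sInf {κ | ∃ B : Set (Set Y), TopologicalSpace.IsTopologicalBasis B ∧ #B = κ}

/-- The `i`-weight of a space: the least infinite cardinal `τ` such that `X` admits a
one-to-one continuous map onto a (Tychonoff) space of weight at most `τ`.
(Such a space has the cardinality of `X`, so it may be taken in the universe of `X`.) -/
noncomputable def iWeight (X : Type u) [TopologicalSpace X] : Cardinal.{u} :=
  sInf {τ | ℵ₀ ≤ τ ∧ ∃ (Y : Type u) (_ : TopologicalSpace Y) (_ : T35Space Y) (f : X → Y),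
    Continuous f ∧ Function.Bijective f ∧ topWeight Y ≤ τ}

/-- The selection principle `S₁(𝒜, ℬ)` for families `𝒜`, `ℬ` of families of subsets of `X`. -/
def SelS1 {X : Type u} (𝒜 ℬ : Set (Set (Set X))) : Prop :=
  ∀ A : ℕ → Set (Set X), (∀ k, A k ∈ 𝒜) →
    ∃ b : ℕ → Set X, (∀ k, b k ∈ A k) ∧ range b ∈ ℬ

/-- The family of open covers of `X`. -/
def openCovers (X : Type u) [TopologicalSpace X] : Set (Set (Set X)) :=
  {𝒰 | (∀ U ∈ 𝒰, IsOpen U) ∧ ⋃₀ 𝒰 = univ}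

/-- `Ω`: the open `ω`-covers of `X`, i.e. the open covers not containing `X` such that every finite
subset of `X` is contained in a member. -/
def omegaCovers (X : Type u) [TopologicalSpace X] : Set (Set (Set X)) :=
  {𝒰 | 𝒰 ∈ openCovers X ∧ univ ∉ 𝒰 ∧ ∀ F : Set X, F.Finite → ∃ U ∈ 𝒰, F ⊆ U}

/-- `Γ`: the open `γ`-covers of `X`, i.e. the infinite open covers such that every point lies in
all but finitely many members. -/
def gammaCovers (X : Type u) [TopologicalSpace X] : Set (Set (Set X)) :=
  {𝒰 | 𝒰 ∈ openCovers X ∧ 𝒰.Infinite ∧ ∀ x : X, {U ∈ 𝒰 | x ∉ U}.Finite}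

/-- `X ⊨ S₁(Ω, Γ)`. -/
def S1OmegaGamma (X : Type u) [TopologicalSpace X] : Prop :=
  SelS1 (omegaCovers X) (gammaCovers X)

/-- The property `γ`: every open `ω`-cover of `X` contains a countable `γ`-cover of `X`. -/
def GammaProperty (X : Type u) [TopologicalSpace X] : Prop :=
  ∀ 𝒰 ∈ omegaCovers X, ∃ 𝒱 ⊆ 𝒰, 𝒱.Countable ∧ 𝒱 ∈ gammaCovers X

/-- `X ⊨ projective S₁(Ω, Γ)`: every second countable (Tychonoff) continuous image of `X`
satisfies `S₁(Ω, Γ)`.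
(An image of `X` is no larger than `X`, so it may be taken in the universe of `X`.) -/
def ProjectiveS1OmegaGamma (X : Type u) [TopologicalSpace X] : Prop :=
  ∀ (Y : Type u) [TopologicalSpace Y] [T35Space Y] [SecondCountableTopology Y] (f : X → Y),
    Continuous f → Function.Surjective f → S1OmegaGamma Y

/-! All the statements reduce to one conjunction: `HasInjectionToRealSequences X` and
`GammaSequenceProperty X`. The first expresses both countable i-weight and separability of `Cp X ℝ`.
The second is the covering condition with `X` allowed as a member and repetitions allowed, which
makes it easy to move along continuous surjections and to finite powers. The γ-property improves
itself to a selection principle (Gerlits–Nagy). Applied to the sets where functions are close to a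
given one, this makes `Cp X Y` Fréchet–Urysohn for every pseudometric `Y`; taking `Y` to be the
space of real sequences settles the countable power. Conversely, Lindelöf finite powers yield a
countable functional refinement of any weak ω-cover. It can be coded into a countable dense set of
functions, or into a second countable image of `X`. -/

/-- A family of open sets such that every finite set is contained in a member; unlike for
`omegaCovers`, the whole space is allowed as a member. -/
structure IsWeakOmegaCover {X : Type u} [TopologicalSpace X] (𝒰 : Set (Set X)) : Prop where
  isOpen : ∀ U ∈ 𝒰, IsOpen U
  exists_superset : ∀ F : Set X, F.Finite → ∃ U ∈ 𝒰, F ⊆ U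

/-- Every weak `ω`-cover contains a sequence whose members eventually contain each given point. -/
def GammaSequenceProperty (X : Type u) [TopologicalSpace X] : Prop :=
  ∀ 𝒰 : Set (Set X), IsWeakOmegaCover 𝒰 →
    ∃ U : ℕ → Set X, (∀ k, U k ∈ 𝒰) ∧ ∀ x, ∀ᶠ k in atTop, x ∈ U k

/-- From every sequence of weak `ω`-covers one can select a sequence of members which eventually
contain each given point. -/
def GammaSelectionProperty (X : Type u) [TopologicalSpace X] : Prop :=
  ∀ 𝒰 : ℕ → Set (Set X), (∀ k, IsWeakOmegaCover (𝒰 k)) →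
    ∃ U : ℕ → Set X, (∀ k, U k ∈ 𝒰 k) ∧ ∀ x, ∀ᶠ k in atTop, x ∈ U k

/-! ### Covering properties and selection principles -/

section Selection

variable {X : Type u} {Y : Type v} [TopologicalSpace X] [TopologicalSpace Y]

theorem IsWeakOmegaCover.of_mem_omegaCovers {𝒰 : Set (Set X)} (h : 𝒰 ∈ omegaCovers X) :
    IsWeakOmegaCover 𝒰 :=
  ⟨h.1.1, h.2.2⟩

theorem IsWeakOmegaCover.mem_omegaCovers {𝒰 : Set (Set X)} (h : IsWeakOmegaCover 𝒰)
    (huniv : univ ∉ 𝒰) : 𝒰 ∈ omegaCovers X := by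
  refine ⟨⟨h.isOpen, eq_univ_of_forall fun x ↦ ?_⟩, huniv, h.exists_superset⟩
  obtain ⟨U, hU, hx⟩ := h.exists_superset {x} (finite_singleton x)
  exact ⟨U, hU, hx rfl⟩

/-- The open sets that refine each of finitely many weak `ω`-covers form a weak `ω`-cover. -/
theorem IsWeakOmegaCover.common_refinement {𝒰 : ℕ → Set (Set X)}
    (h : ∀ k, IsWeakOmegaCover (𝒰 k)) (k : ℕ) :
    IsWeakOmegaCover {V | IsOpen V ∧ ∀ i ≤ k, ∃ U ∈ 𝒰 i, V ⊆ U} := by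
  refine ⟨fun V hV ↦ hV.1, fun F hF ↦ ?_⟩
  choose U hU hFU using fun i ↦ (h i).exists_superset F hF
  refine ⟨⋂ i ∈ Iic k, U i, ⟨(finite_Iic k).isOpen_biInter fun i _ ↦ (h i).isOpen _ (hU i),
    fun i hi ↦ ⟨U i, hU i, biInter_subset_of_mem hi⟩⟩, subset_iInter₂ fun i _ ↦ hFU i⟩

/-- Members of the `k`-th common refinement are made to miss a marked point `p k`. A sequence
eventually containing every `p k` cannot keep using low levels, so a subsequence refines the covers
one by one. A finite space needs no marking, being itself a finite set to cover. -/
theorem GammaSequenceProperty.gammaSelectionProperty [T1Space X] (h : GammaSequenceProperty X) :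
    GammaSelectionProperty X := by
  intro 𝒰 h𝒰
  rcases finite_or_infinite X with hfin | hinf
  · choose U hU hFU using fun k ↦ (h𝒰 k).exists_superset univ finite_univ
    exact ⟨U, hU, fun x ↦ .of_forall fun k ↦ hFU k (mem_univ x)⟩
  let p : ℕ ↪ X := Infinite.natEmbedding X
  have hcov : IsWeakOmegaCover
      {W | ∃ k, (IsOpen W ∧ ∀ i ≤ k, ∃ U ∈ 𝒰 i, W ⊆ U) ∧ p k ∉ W} := by
    refine ⟨fun W ⟨k, hW, _⟩ ↦ hW.1, fun F hF ↦ ?_⟩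
    obtain ⟨k, hk⟩ : ∃ k, p k ∉ F := by
      by_contra! hall
      exact (infinite_range_of_injective p.injective) (hF.subset (range_subset_iff.2 hall))
    obtain ⟨V, ⟨hVo, hV⟩, hFV⟩ := (IsWeakOmegaCover.common_refinement h𝒰 k).exists_superset F hF
    refine ⟨V \ {p k}, ⟨k, ⟨hVo.sdiff isClosed_singleton, fun i hi ↦ ?_⟩, by simp⟩,
      subset_sdiff_singleton hFV hk⟩
    obtain ⟨U, hU, hVU⟩ := hV i hi
    exact ⟨U, hU, sdiff_subset.trans hVU⟩
  obtain ⟨W, hW, hev⟩ := h _ hcov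
  choose level hWlevel hp using hW
  have hlevel : ∀ i, ∃ j ≥ i, i ≤ level j := by
    intro i
    have : ∀ᶠ j in atTop, ∀ k ∈ Iio i, p k ∈ W j :=
      (finite_Iio i).eventually_all.2 fun k _ ↦ hev (p k)
    obtain ⟨j, hj, hij⟩ := (this.and (eventually_ge_atTop i)).exists
    exact ⟨j, hij, not_lt.1 fun hlt ↦ hp j (hj _ hlt)⟩
  choose σ hσ hσl using hlevel
  choose U hU hWU using fun i ↦ (hWlevel (σ i)).2 i (hσl i)
  exact ⟨U, hU, fun x ↦
    ((tendsto_atTop_mono hσ tendsto_id).eventually (hev x)).mono fun i hi ↦ hWU i hi⟩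

theorem GammaSelectionProperty.s1OmegaGamma (h : GammaSelectionProperty X) : S1OmegaGamma X := by
  intro A hA
  obtain ⟨U, hU, hev⟩ := h A fun k ↦ .of_mem_omegaCovers (hA k)
  refine ⟨U, hU, ⟨⟨?_, eq_univ_of_forall fun x ↦ ?_⟩, fun hfin ↦ ?_, fun x ↦ ?_⟩⟩
  · rintro _ ⟨k, rfl⟩
    exact (hA k).1.1 _ (hU k)
  · obtain ⟨k, hk⟩ := (hev x).exists
    exact ⟨U k, mem_range_self k, hk⟩
  -- With a finite range some member recurs infinitely often; it then contains every point, but an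
  -- ω-cover excludes the whole space.
  · obtain ⟨k, hk⟩ : ∃ k, ∃ᶠ m in atTop, U m = U k := by
      by_contra! hne
      have : ∀ᶠ m in atTop, ∀ V ∈ range U, U m ≠ V := by
        refine hfin.eventually_all.2 ?_
        rintro _ ⟨k, rfl⟩
        simpa using hne k
      obtain ⟨m, hm⟩ := this.exists
      exact hm _ (mem_range_self m) rfl
    refine (hA k).2.1 ?_
    convert hU k
    refine (eq_univ_of_forall fun x ↦ ?_).symm
    obtain ⟨m, hm, hx⟩ := (hk.and_eventually (hev x)).exists
    exact hm ▸ hx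
  · obtain ⟨N, hN⟩ := eventually_atTop.1 (hev x)
    refine ((finite_Iio N).image U).subset ?_
    rintro _ ⟨⟨k, rfl⟩, hk⟩
    exact ⟨k, not_le.1 fun hle ↦ hk (hN k hle), rfl⟩

theorem S1OmegaGamma.gammaProperty (h : S1OmegaGamma X) : GammaProperty X := by
  intro 𝒰 h𝒰
  obtain ⟨b, hb, hγ⟩ := h (fun _ ↦ 𝒰) fun _ ↦ h𝒰
  exact ⟨range b, range_subset_iff.2 hb, countable_range b, hγ⟩

theorem GammaProperty.gammaSequenceProperty (h : GammaProperty X) : GammaSequenceProperty X := by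
  intro 𝒰 h𝒰
  by_cases huniv : univ ∈ 𝒰
  · exact ⟨fun _ ↦ univ, fun _ ↦ huniv, fun x ↦ .of_forall fun _ ↦ mem_univ x⟩
  obtain ⟨𝒱, h𝒱, -, -, hinf, hγ⟩ := h 𝒰 (h𝒰.mem_omegaCovers huniv)
  refine ⟨fun k ↦ Set.Infinite.natEmbedding 𝒱 hinf k,
    fun k ↦ h𝒱 (Set.Infinite.natEmbedding 𝒱 hinf k).2, fun x ↦ ?_⟩
  have hinj : Function.Injective fun k ↦ (Set.Infinite.natEmbedding 𝒱 hinf k : Set X) :=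
    Subtype.val_injective.comp (Set.Infinite.natEmbedding 𝒱 hinf).injective
  have := (hγ x).preimage (f := fun k ↦ (Set.Infinite.natEmbedding 𝒱 hinf k : Set X)) hinj.injOn
  rw [← Nat.cofinite_eq_atTop]
  exact this.subset fun k hk ↦ ⟨(Set.Infinite.natEmbedding 𝒱 hinf k).2, hk⟩

theorem gammaProperty_iff_gammaSequenceProperty [T1Space X] :
    GammaProperty X ↔ GammaSequenceProperty X :=
  ⟨fun h ↦ h.gammaSequenceProperty,
    fun h ↦ h.gammaSelectionProperty.s1OmegaGamma.gammaProperty⟩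

theorem s1OmegaGamma_iff_gammaSequenceProperty [T1Space X] :
    S1OmegaGamma X ↔ GammaSequenceProperty X :=
  ⟨fun h ↦ h.gammaProperty.gammaSequenceProperty, fun h ↦ h.gammaSelectionProperty.s1OmegaGamma⟩

theorem GammaSequenceProperty.of_surjective (h : GammaSequenceProperty X) {f : X → Y}
    (hf : Continuous f) (hsurj : Function.Surjective f) : GammaSequenceProperty Y := by
  intro 𝒰 h𝒰
  have hcov : IsWeakOmegaCover ((f ⁻¹' ·) '' 𝒰) := by
    refine ⟨?_, fun F hF ↦ ?_⟩
    · rintro _ ⟨U, hU, rfl⟩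
      exact (h𝒰.isOpen U hU).preimage hf
    · obtain ⟨U, hU, hFU⟩ := h𝒰.exists_superset (f '' F) (hF.image f)
      exact ⟨_, ⟨U, hU, rfl⟩, image_subset_iff.1 hFU⟩
  obtain ⟨V, hV, hev⟩ := h _ hcov
  choose U hU hUV using hV
  refine ⟨U, hU, fun y ↦ ?_⟩
  obtain ⟨x, rfl⟩ := hsurj y
  exact (hev x).mono fun k hk ↦ by rw [← hUV k] at hk; exact hk

/-- A finite set whose finite power lies in an open set has an open neighbourhood with the same
property. -/
theorem exists_isOpen_pi_subset {n : ℕ} {F : Set X} (hF : F.Finite) {U : Set (Fin n → X)}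
    (hU : IsOpen U) (hFU : (univ.pi fun _ ↦ F) ⊆ U) :
    ∃ V, IsOpen V ∧ F ⊆ V ∧ (univ.pi fun _ ↦ V) ⊆ U := by
  have hpt : ∀ y ∈ univ.pi fun _ : Fin n ↦ F, ∃ u : Fin n → Set X,
      (∀ i, IsOpen (u i) ∧ y i ∈ u i) ∧ univ.pi u ⊆ U := fun y hy ↦
    isOpen_pi_iff'.1 hU y (hFU hy)
  choose! u hu huU using hpt
  have hfin : (univ.pi fun _ : Fin n ↦ F).Finite := Finite.pi fun _ ↦ hF
  -- A single neighbourhood of `x` must serve all the finitely many tuples and coordinates at which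
  -- `x` occurs.
  have hnhds : ∀ x ∈ F, ∃ N, IsOpen N ∧ x ∈ N ∧
      ∀ y ∈ univ.pi fun _ : Fin n ↦ F, ∀ i, y i = x → N ⊆ u y i := by
    intro x _
    refine ⟨⋂ y ∈ univ.pi fun _ : Fin n ↦ F, ⋂ i, ⋂ (_ : y i = x), u y i,
      hfin.isOpen_biInter fun y hy ↦ isOpen_iInter_of_finite fun i ↦
        isOpen_iInter_of_finite fun _ ↦ (hu y hy i).1, ?_, ?_⟩
    · simp only [mem_iInter]
      rintro y hy i rfl
      exact (hu y hy i).2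
    · intro y hy i hi z hz
      simp only [mem_iInter] at hz
      exact hz y hy i hi
  choose! N hNo hxN hN using hnhds
  refine ⟨⋃ x ∈ F, N x, isOpen_biUnion hNo, fun x hx ↦ mem_biUnion hx (hxN x hx), fun z hz ↦ ?_⟩
  have hz' : ∀ i, ∃ x ∈ F, z i ∈ N x := fun i ↦ by simpa using hz i (mem_univ i)
  choose y hyF hzy using hz'
  exact huU y (fun i _ ↦ hyF i) fun i _ ↦ hN (y i) (hyF i) y (fun i _ ↦ hyF i) i rfl (hzy i)

/-- The open `V` whose `n`-th power fits inside a member form a weak ω-cover of `X`, and a tuple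
lies in that power once all its coordinates lie in `V`. -/
theorem GammaSequenceProperty.pi (h : GammaSequenceProperty X) (n : ℕ) :
    GammaSequenceProperty (Fin n → X) := by
  intro 𝒰 h𝒰
  have hcov : IsWeakOmegaCover {V : Set X | IsOpen V ∧ ∃ U ∈ 𝒰, (univ.pi fun _ ↦ V) ⊆ U} := by
    refine ⟨fun V hV ↦ hV.1, fun F hF ↦ ?_⟩
    obtain ⟨U, hU, hFU⟩ := h𝒰.exists_superset _ (Finite.pi fun _ : Fin n ↦ hF)
    obtain ⟨V, hVo, hFV, hVU⟩ := exists_isOpen_pi_subset hF (h𝒰.isOpen U hU) hFU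
    exact ⟨V, ⟨hVo, U, hU, hVU⟩, hFV⟩
  obtain ⟨V, hV, hev⟩ := h _ hcov
  choose hVo U hU hVU using hV
  refine ⟨U, hU, fun x ↦ ?_⟩
  filter_upwards [eventually_all.2 fun i ↦ hev (x i)] with k hk
  exact hVU k fun i _ ↦ hk i

theorem gammaSequenceProperty_pi_iff {n : ℕ} (hn : 1 ≤ n) :
    GammaSequenceProperty (Fin n → X) ↔ GammaSequenceProperty X :=
  ⟨fun h ↦ h.of_surjective (continuous_apply (⟨0, hn⟩ : Fin n)) fun x ↦ ⟨fun _ ↦ x, rfl⟩,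
    fun h ↦ h.pi n⟩

theorem GammaSequenceProperty.projectiveS1OmegaGamma (h : GammaSequenceProperty X) :
    ProjectiveS1OmegaGamma X := fun _ _ _ _ _ hf hsurj ↦
  s1OmegaGamma_iff_gammaSequenceProperty.2 (h.of_surjective hf hsurj)

/-- If all finite powers of a space are Lindelöf, then every weak `ω`-cover has a countable
weak `ω`-subcover. -/
theorem IsWeakOmegaCover.exists_countable (hX : ∀ k : ℕ, LindelofSpace (Fin k → X))
    {𝒰 : Set (Set X)} (h𝒰 : IsWeakOmegaCover 𝒰) :
    ∃ 𝒱 ⊆ 𝒰, 𝒱.Countable ∧ IsWeakOmegaCover 𝒱 := by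
  -- A `k`-point set inside `V` is a point of the `k`-th power of `V`, so ω-covers become ordinary
  -- covers of the powers.
  have hsub : ∀ k : ℕ, ∃ 𝒱 ⊆ 𝒰, 𝒱.Countable ∧
      (univ : Set (Fin k → X)) ⊆ ⋃ V ∈ 𝒱, univ.pi fun _ ↦ V := by
    intro k
    refine isLindelof_univ.elim_countable_subcover_image
      (fun U hU ↦ isOpen_set_pi finite_univ fun _ _ ↦ h𝒰.isOpen U hU) fun x _ ↦ ?_
    obtain ⟨U, hU, hxU⟩ := h𝒰.exists_superset (range x) (finite_range x)
    exact mem_biUnion hU fun i _ ↦ hxU (mem_range_self i)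
  choose 𝒱 h𝒱 hcount hcov using hsub
  refine ⟨⋃ k, 𝒱 k, iUnion_subset h𝒱, countable_iUnion hcount,
    fun V hV ↦ h𝒰.isOpen V (iUnion_subset h𝒱 hV), fun F hF ↦ ?_⟩
  obtain ⟨k, x, -, rfl⟩ := hF.fin_param
  obtain ⟨V, hV, hx⟩ := mem_iUnion₂.1 (hcov k (mem_univ x))
  exact ⟨V, mem_iUnion.2 ⟨k, hV⟩, range_subset_iff.2 fun i ↦ hx i (mem_univ i)⟩

end Selection

/-! ### Pointwise convergence and covers -/

section FunctionSpaces

variable {X : Type u} [TopologicalSpace X]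

theorem tendsto_Cp_iff {Y : Type v} [TopologicalSpace Y] {ι : Type*} {l : Filter ι}
    {f : ι → Cp X Y} {g : Cp X Y} :
    Tendsto f l (𝓝 g) ↔ ∀ x, Tendsto (fun i ↦ (f i).1 x) l (𝓝 (g.1 x)) := by
  rw [tendsto_subtype_rng, tendsto_pi_nhds]

theorem mem_closure_Cp_iff {Y : Type v} [PseudoMetricSpace Y] {A : Set (Cp X Y)} {f : Cp X Y} :
    f ∈ closure A ↔ ∀ F : Set X, F.Finite → ∀ ε > 0,
      ∃ g ∈ A, ∀ x ∈ F, dist (g.1 x) (f.1 x) < ε := by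
  have hbasis : (𝓝 f).HasBasis (fun p : Set X × (X → ℝ) ↦ p.1.Finite ∧ ∀ i ∈ p.1, 0 < p.2 i)
      fun p ↦ Subtype.val ⁻¹' (p.1.pi fun i ↦ Metric.ball (f.1 i) (p.2 i)) := by
    rw [nhds_subtype_eq_comap, nhds_pi]
    exact (hasBasis_pi fun x ↦ Metric.nhds_basis_ball).comap _
  rw [mem_closure_iff_nhds_basis' hbasis]
  constructor
  · intro h F hF ε hε
    obtain ⟨g, hg, hgA⟩ := h (F, fun _ ↦ ε) ⟨hF, fun _ _ ↦ hε⟩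
    exact ⟨g, hgA, fun x hx ↦ hg x hx⟩
  · rintro h ⟨F, δ⟩ ⟨hF, hδ⟩
    have hev : ∀ᶠ ε in 𝓝[>] (0 : ℝ), ∀ x ∈ F, ε < δ x := by
      refine hF.eventually_all.2 fun x hx ↦ ?_
      exact nhdsWithin_le_nhds (Iio_mem_nhds (hδ x hx))
    obtain ⟨ε, hεδ, hε⟩ := (hev.and self_mem_nhdsWithin).exists
    obtain ⟨g, hg, hgf⟩ := h F hF ε hε
    exact ⟨g, fun x hx ↦ (hgf x hx).trans (hεδ x hx), hg⟩

theorem dense_Cp_iff {Y : Type v} [PseudoMetricSpace Y] {A : Set (Cp X Y)} :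
    Dense A ↔ ∀ f : Cp X Y, ∀ F : Set X, F.Finite → ∀ ε > 0,
      ∃ g ∈ A, ∀ x ∈ F, dist (g.1 x) (f.1 x) < ε :=
  forall_congr' fun _ ↦ mem_closure_Cp_iff

theorem GammaSelectionProperty.frechetUrysohnSpace (h : GammaSelectionProperty X)
    (Y : Type v) [PseudoMetricSpace Y] : FrechetUrysohnSpace (Cp X Y) := by
  refine ⟨fun A f hf ↦ ?_⟩
  rw [mem_closure_Cp_iff] at hf
  have hcov : ∀ k : ℕ, IsWeakOmegaCover
      ((fun g : Cp X Y ↦ {x | dist (g.1 x) (f.1 x) < 1 / (k + 1 : ℝ)}) '' A) := by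
    refine fun k ↦ ⟨?_, fun F hF ↦ ?_⟩
    · rintro _ ⟨g, -, rfl⟩
      exact isOpen_lt (g.2.dist f.2) continuous_const
    · obtain ⟨g, hg, hgF⟩ := hf F hF (1 / (k + 1 : ℝ)) Nat.one_div_pos_of_nat
      exact ⟨_, ⟨g, hg, rfl⟩, hgF⟩
  obtain ⟨U, hU, hev⟩ := h _ hcov
  choose g hg hgU using hU
  refine ⟨g, hg, tendsto_Cp_iff.2 fun x ↦ tendsto_iff_dist_tendsto_zero.2 ?_⟩
  refine squeeze_zero' (.of_forall fun _ ↦ dist_nonneg) ?_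
    tendsto_one_div_add_atTop_nhds_zero_nat
  filter_upwards [hev x] with k hk
  rw [← hgU k] at hk
  exact le_of_lt hk

/-- In a completely regular space a finite set and a disjoint closed set are separated by a
continuous real function. -/
theorem exists_continuous_one_of_finite [CompletelyRegularSpace X] {F U : Set X} (hF : F.Finite)
    (hU : IsOpen U) (hFU : F ⊆ U) :
    ∃ φ : X → ℝ, Continuous φ ∧ (∀ x ∈ F, φ x = 1) ∧ ∀ x ∉ U, φ x = 0 := by
  have hsep : ∀ x ∈ F, ∃ g : X → unitInterval, Continuous g ∧ g x = 0 ∧ EqOn g 1 Uᶜ := fun x hx ↦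
    CompletelyRegularSpace.completely_regular x Uᶜ hU.isClosed_compl fun h ↦ h (hFU hx)
  choose! g hg hg0 hg1 using hsep
  refine ⟨fun y ↦ 1 - ∏ x ∈ hF.toFinset, (g x y : ℝ), continuous_const.sub
    (continuous_finsetProd _ fun x hx ↦ continuous_subtype_val.comp (hg x (hF.mem_toFinset.1 hx))),
    fun x hx ↦ ?_, fun y hy ↦ ?_⟩
  · beta_reduce
    rw [Finset.prod_eq_zero (hF.mem_toFinset.2 hx) (by rw [hg0 x hx]; rfl), sub_zero]
  · beta_reduce
    rw [Finset.prod_eq_one fun x hx ↦ ?_, sub_self]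
    simp [hg1 x (hF.mem_toFinset.1 hx) hy]

/-- In a completely regular space with Lindelöf finite powers, every weak `ω`-cover has a countable
functional refinement. -/
theorem IsWeakOmegaCover.exists_functions [CompletelyRegularSpace X]
    (hX : ∀ k : ℕ, LindelofSpace (Fin k → X)) {𝒰 : Set (Set X)} (h𝒰 : IsWeakOmegaCover 𝒰) :
    ∃ (φ : ℕ → X → ℝ) (U : ℕ → Set X), (∀ i, Continuous (φ i)) ∧ (∀ i, U i ∈ 𝒰) ∧
      (∀ i, ∀ x ∉ U i, φ i x = 0) ∧ ∀ F : Set X, F.Finite → ∃ i, ∀ x ∈ F, φ i x = 1 := by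
  have hcov : IsWeakOmegaCover {W : Set X | IsOpen W ∧ ∃ φ : X → ℝ, Continuous φ ∧
      ∃ U ∈ 𝒰, (∀ x ∉ U, φ x = 0) ∧ ∀ x ∈ W, φ x = 1} := by
    refine ⟨fun W hW ↦ hW.1, fun F hF ↦ ?_⟩
    obtain ⟨U, hU, hFU⟩ := h𝒰.exists_superset F hF
    obtain ⟨φ, hφ, hφ1, hφ0⟩ := exists_continuous_one_of_finite hF (h𝒰.isOpen U hU) hFU
    -- Truncation makes the function exactly 1 on an open set while keeping it 0 off `U`.
    refine ⟨{x | 1 / 2 < φ x}, ⟨isOpen_lt continuous_const hφ, fun x ↦ min 1 (2 * max 0 (φ x)),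
      by fun_prop, U, hU, fun x hx ↦ by simp [hφ0 x hx], fun x hx ↦ min_eq_left ?_⟩, fun x hx ↦ ?_⟩
    · have : φ x ≤ max 0 (φ x) := le_max_right _ _
      have hx : 1 / 2 < φ x := hx
      linarith
    · rw [mem_ofPred_eq, hφ1 x hx]
      norm_num
  obtain ⟨𝒱, h𝒱, hcount, hcov⟩ := hcov.exists_countable hX
  obtain ⟨V₀, hV₀, -⟩ := hcov.exists_superset ∅ finite_empty
  obtain ⟨V, rfl⟩ := hcount.exists_eq_range ⟨V₀, hV₀⟩
  choose _ φ hφ U hU hφ0 hφ1 using fun i ↦ h𝒱 (mem_range_self i)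
  refine ⟨φ, U, hφ, hU, hφ0, fun F hF ↦ ?_⟩
  obtain ⟨_, ⟨i, rfl⟩, hF⟩ := hcov.exists_superset F hF
  exact ⟨i, fun x hx ↦ hφ1 i x (hF hx)⟩

/-- The blend `d * φ + (1 - φ)` equals `d` where `φ = 1`, so blends of a dense set are dense, and
equals 1 off `U`. Blends converging to 0 therefore have their sets `U` eventually containing each
point. -/
theorem StronglySequentiallySeparable.gammaSequenceProperty [CompletelyRegularSpace X]
    (hX : ∀ k : ℕ, LindelofSpace (Fin k → X))
    (h : StronglySequentiallySeparable (Cp X ℝ)) : GammaSequenceProperty X := by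
  intro 𝒰 h𝒰
  obtain ⟨φ, U, hφ, hU, hφ0, hφ1⟩ := h𝒰.exists_functions hX
  obtain ⟨hsep, hseq⟩ := h
  obtain ⟨D, hDc, hD⟩ := TopologicalSpace.exists_countable_dense (Cp X ℝ)
  let blend : Cp X ℝ × ℕ → Cp X ℝ := fun p ↦
    ⟨fun x ↦ p.1.1 x * φ p.2 x + (1 - φ p.2 x),
      (p.1.2.mul (hφ p.2)).add (continuous_const.sub (hφ p.2))⟩
  have hdense : Dense (blend '' D ×ˢ univ) := by
    refine dense_Cp_iff.2 fun f F hF ε hε ↦ ?_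
    obtain ⟨i, hi⟩ := hφ1 F hF
    obtain ⟨d, hd, hdf⟩ := dense_Cp_iff.1 hD f F hF ε hε
    exact ⟨_, ⟨(d, i), ⟨hd, mem_univ i⟩, rfl⟩, fun x hx ↦ by simpa [blend, hi x hx] using hdf x hx⟩
  have hmem : (⟨fun _ ↦ 0, continuous_const⟩ : Cp X ℝ) ∈ seqClosure (blend '' D ×ˢ univ) := by
    rw [hseq _ ((hDc.prod countable_univ).image _) hdense]
    exact mem_univ _
  obtain ⟨g, hg, hlim⟩ := hmem
  choose p _ hp using hg
  refine ⟨fun k ↦ U (p k).2, fun k ↦ hU _, fun x ↦ ?_⟩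
  filter_upwards [(tendsto_Cp_iff.1 hlim x).eventually (gt_mem_nhds one_pos)] with k hk
  by_contra hx
  rw [← hp k] at hk
  simp [blend, hφ0 _ x hx] at hk

theorem ProjectiveS1OmegaGamma.gammaSequenceProperty [CompletelyRegularSpace X]
    (hX : ∀ k : ℕ, LindelofSpace (Fin k → X)) (h : ProjectiveS1OmegaGamma X) :
    GammaSequenceProperty X := by
  intro 𝒰 h𝒰
  obtain ⟨φ, U, hφ, hU, hφ0, hφ1⟩ := h𝒰.exists_functions hX
  -- The lift puts the image in the universe of `X`, as the projective property demands.
  let Φ : X → ULift.{u} ℕ → ℝ := fun x i ↦ φ i.down x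
  have hΦ : Continuous Φ := continuous_pi fun i ↦ hφ i.down
  have hY : GammaSequenceProperty (range Φ) := s1OmegaGamma_iff_gammaSequenceProperty.1
    (h (range Φ) (rangeFactorization Φ) hΦ.rangeFactorization rangeFactorization_surjective)
  have hcov : IsWeakOmegaCover (range fun (i : ℕ) ↦ {y : range Φ | 0 < y.1 ⟨i⟩}) := by
    refine ⟨?_, fun F hF ↦ ?_⟩
    · rintro _ ⟨i, rfl⟩
      exact isOpen_lt continuous_const ((continuous_apply _).comp continuous_subtype_val)
    · choose s hs using fun y : range Φ ↦ y.2
      obtain ⟨i, hi⟩ := hφ1 (s '' F) (hF.image s)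
      refine ⟨_, ⟨i, rfl⟩, fun y hy ↦ ?_⟩
      have : y.1 ⟨i⟩ = 1 := by rw [← hs y]; exact hi _ (mem_image_of_mem s hy)
      simp [this]
  obtain ⟨W, hW, hev⟩ := hY _ hcov
  choose i hi using hW
  refine ⟨fun k ↦ U (i k), fun k ↦ hU _, fun x ↦ ?_⟩
  filter_upwards [hev (rangeFactorization Φ x)] with k hk
  by_contra hx
  rw [← hi k] at hk
  have : 0 < φ (i k) x := hk
  simp [hφ0 _ x hx] at this

/-! ### Countable i-weight and separability -/

/-- A space admitting a one-to-one continuous map into the separable Fréchet space of real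
sequences, that is, a space with a coarser separable metrizable topology. -/
def HasInjectionToRealSequences (X : Type u) [TopologicalSpace X] : Prop :=
  ∃ e : X → ℕ → ℝ, Continuous e ∧ Function.Injective e

theorem HasInjectionToRealSequences.comp {Y : Type v} [TopologicalSpace Y]
    (h : HasInjectionToRealSequences Y) {f : X → Y} (hf : Continuous f)
    (hinj : Function.Injective f) : HasInjectionToRealSequences X :=
  let ⟨e, he, hei⟩ := h
  ⟨e ∘ f, he.comp hf, hei.comp hinj⟩

theorem hasInjectionToRealSequences_of_secondCountable [T3Space X] [SecondCountableTopology X] :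
    HasInjectionToRealSequences X := by
  obtain ⟨f, hf⟩ := TopologicalSpace.exists_embedding_l_infty X
  refine ⟨fun x n ↦ f x n, continuous_pi fun n ↦ ?_, fun x y hxy ↦ hf.injective ?_⟩
  · exact (continuous_eval_const n).comp hf.continuous
  · ext n
    exact congrFun hxy n

theorem hasInjectionToRealSequences_pi_iff {n : ℕ} (hn : 1 ≤ n) :
    HasInjectionToRealSequences (Fin n → X) ↔ HasInjectionToRealSequences X := by
  constructor
  · intro h
    exact h.comp (f := fun x _ ↦ x) (by fun_prop) fun x y hxy ↦ congrFun hxy ⟨0, hn⟩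
  · rintro ⟨e, he, hei⟩
    have : HasInjectionToRealSequences (Fin n → ℕ → ℝ) :=
      hasInjectionToRealSequences_of_secondCountable
    exact this.comp (f := fun x i ↦ e (x i)) (by fun_prop) fun x y hxy ↦
      funext fun i ↦ hei (congrFun hxy i)

theorem topWeight_le_aleph0_iff : topWeight X ≤ ℵ₀ ↔ SecondCountableTopology X := by
  constructor
  · intro h
    have hne : {κ | ∃ B : Set (Set X), TopologicalSpace.IsTopologicalBasis B ∧ #B = κ}.Nonempty :=
      ⟨_, _, TopologicalSpace.isTopologicalBasis_opens, rfl⟩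
    obtain ⟨B, hB, hcard⟩ := csInf_mem hne
    exact hB.secondCountableTopology (Cardinal.le_aleph0_iff_set_countable.1 (hcard.trans_le h))
  · intro _
    have hle : topWeight X ≤ #(TopologicalSpace.countableBasis X) :=
      csInf_le' ⟨_, TopologicalSpace.isBasis_countableBasis X, rfl⟩
    exact hle.trans (Cardinal.le_aleph0_iff_set_countable.2
      (TopologicalSpace.countable_countableBasis X))

theorem iWeight_eq_aleph0_iff : iWeight X = ℵ₀ ↔ HasInjectionToRealSequences X := by
  constructor
  · intro h
    have hmem : iWeight X ∈ {τ | ℵ₀ ≤ τ ∧ ∃ (Y : Type u) (_ : TopologicalSpace Y) (_ : T35Space Y)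
        (f : X → Y), Continuous f ∧ Function.Bijective f ∧ topWeight Y ≤ τ} := by
      -- The infimum of the empty set is 0 by convention, hence not `ℵ₀`.
      refine csInf_mem (nonempty_iff_ne_empty.2 fun hempty ↦ Cardinal.aleph0_ne_zero ?_)
      rw [← h, iWeight, hempty, Cardinal.sInf_empty]
    obtain ⟨-, Y, _, _, f, hf, hbij, hw⟩ := hmem
    rw [h, topWeight_le_aleph0_iff] at hw
    exact hasInjectionToRealSequences_of_secondCountable.comp hf hbij.injective
  · rintro ⟨e, he, hinj⟩
    let Φ : X → ULift.{u} ℕ → ℝ := fun x i ↦ e x i.down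
    have hΦ : Continuous Φ := continuous_pi fun i ↦ (continuous_apply i.down).comp he
    have hΦinj : Function.Injective Φ := fun x y hxy ↦
      hinj (funext fun n ↦ congrFun hxy ⟨n⟩)
    refine le_antisymm (csInf_le' ⟨le_rfl, range Φ, inferInstance, inferInstance,
      rangeFactorization Φ, hΦ.rangeFactorization,
      ⟨fun x y hxy ↦ hΦinj (congrArg Subtype.val hxy), rangeFactorization_surjective⟩,
      topWeight_le_aleph0_iff.2 inferInstance⟩) ?_
    refine le_csInf ?_ fun τ hτ ↦ hτ.1
    exact ⟨_, le_rfl, range Φ, inferInstance, inferInstance,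
      rangeFactorization Φ, hΦ.rangeFactorization,
      ⟨fun x y hxy ↦ hΦinj (congrArg Subtype.val hxy), rangeFactorization_surjective⟩,
      topWeight_le_aleph0_iff.2 inferInstance⟩

theorem hasInjectionToRealSequences_of_separableSpace [T35Space X]
    [TopologicalSpace.SeparableSpace (Cp X ℝ)] : HasInjectionToRealSequences X := by
  have : Nonempty (Cp X ℝ) := ⟨⟨fun _ ↦ 0, continuous_const⟩⟩
  let d := TopologicalSpace.denseSeq (Cp X ℝ)
  refine ⟨fun x n ↦ (d n).1 x, continuous_pi fun n ↦ (d n).2, fun x y hxy ↦ ?_⟩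
  by_contra hne
  obtain ⟨φ, hφ, hφ1, hφ0⟩ := exists_continuous_one_of_finite (finite_singleton x)
    (isOpen_compl_singleton (x := y)) (by simpa [eq_comm] using hne)
  obtain ⟨_, ⟨n, rfl⟩, hn⟩ := dense_Cp_iff.1 (TopologicalSpace.denseRange_denseSeq (Cp X ℝ))
    ⟨φ, hφ⟩ {x, y} (by simp) (1 / 2) (by norm_num)
  have hx := hn x (by simp)
  have hy := hn y (by simp)
  have hxyn : (d n).1 x = (d n).1 y := congrFun hxy n
  rw [hxyn, show (⟨φ, hφ⟩ : Cp X ℝ).1 x = 1 from hφ1 x rfl, Real.dist_eq, abs_lt] at hx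
  rw [show (⟨φ, hφ⟩ : Cp X ℝ).1 y = 0 from hφ0 y (by simp), Real.dist_eq, abs_lt] at hy
  linarith [hx.1, hy.2]

/-- Through `EReal`, `X` injects into a compact metrizable space, whose space of continuous real
functions is separable. By Tietze extension, pullbacks of these functions attain any prescribed
values on a finite set. -/
theorem HasInjectionToRealSequences.separableSpace (h : HasInjectionToRealSequences X) :
    TopologicalSpace.SeparableSpace (Cp X ℝ) := by
  obtain ⟨e, he, hinj⟩ := h
  let ι : X → ℕ → EReal := fun x n ↦ (e x n : EReal)
  have hι : Continuous ι := continuous_pi fun n ↦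
    continuous_coe_real_ereal.comp ((continuous_apply n).comp he)
  have hιinj : Function.Injective ι := fun x y hxy ↦
    hinj (funext fun n ↦ EReal.coe_injective (congrFun hxy n))
  let r : C(ℕ → EReal, ℝ) → Cp X ℝ := fun g ↦ ⟨g ∘ ι, g.continuous.comp hι⟩
  have hr : Continuous r := Continuous.subtype_mk
    (continuous_pi fun x ↦ continuous_eval_const (ι x)) _
  refine DenseRange.separableSpace (f := r) (dense_Cp_iff.2 fun f F hF ε hε ↦ ?_) hr
  have : Finite (ι '' F) := hF.image ι
  have hclosed : IsClosed (ι '' F) := (hF.image ι).isClosed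
  let g₀ : C(ι '' F, ℝ) := ⟨fun y ↦ f.1 y.2.choose, continuous_of_discreteTopology⟩
  obtain ⟨g, hg⟩ := ContinuousMap.exists_restrict_eq hclosed g₀
  refine ⟨r g, mem_range_self g, fun x hx ↦ ?_⟩
  have hmem : ι x ∈ ι '' F := mem_image_of_mem ι hx
  have hgx : g (ι x) = f.1 hmem.choose := DFunLike.congr_fun hg ⟨ι x, hmem⟩
  rw [hιinj hmem.choose_spec.2] at hgx
  simpa [r, hgx] using hε

theorem separableSpace_Cp_iff [T35Space X] :
    TopologicalSpace.SeparableSpace (Cp X ℝ) ↔ HasInjectionToRealSequences X :=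
  ⟨fun _ ↦ hasInjectionToRealSequences_of_separableSpace, fun h ↦ h.separableSpace⟩

end FunctionSpaces

/-! ### Strong sequential separability, powers and homeomorphisms -/

theorem FrechetUrysohnSpace.stronglySequentiallySeparable {S : Type u} [TopologicalSpace S]
    [TopologicalSpace.SeparableSpace S] [FrechetUrysohnSpace S] :
    StronglySequentiallySeparable S :=
  ⟨inferInstance, fun D _ hD ↦ by rw [seqClosure_eq_closure, hD.closure_eq]⟩

theorem StronglySequentiallySeparable.of_homeomorph {S : Type u} {T : Type v} [TopologicalSpace S]
    [TopologicalSpace T] (h : StronglySequentiallySeparable S) (e : S ≃ₜ T) :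
    StronglySequentiallySeparable T := by
  obtain ⟨hsep, hseq⟩ := h
  refine ⟨e.surjective.denseRange.separableSpace e.continuous, fun D hDc hD ↦
    eq_univ_of_forall fun t ↦ ?_⟩
  have hmem : e.symm t ∈ seqClosure (e.symm '' D) := by
    rw [hseq _ (hDc.image _) (e.symm.surjective.denseRange.dense_image e.symm.continuous hD)]
    exact mem_univ _
  obtain ⟨s, hs, hlim⟩ := hmem
  refine ⟨e ∘ s, fun k ↦ ?_, ?_⟩
  · obtain ⟨d, hd, hds⟩ := hs k
    simpa [← hds] using hd
  · simpa using (e.continuous.tendsto _).comp hlim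

theorem StronglySequentiallySeparable.of_pi {S : Type u} [TopologicalSpace S]
    (h : StronglySequentiallySeparable (ℕ → S)) : StronglySequentiallySeparable S := by
  obtain ⟨hsep, hseq⟩ := h
  have hsurj : Function.Surjective fun s : ℕ → S ↦ s 0 := fun s ↦ ⟨fun _ ↦ s, rfl⟩
  refine ⟨hsurj.denseRange.separableSpace (continuous_apply 0), fun D hDc hD ↦
    eq_univ_of_forall fun s ↦ ?_⟩
  obtain ⟨E, hEc, hE⟩ := TopologicalSpace.exists_countable_dense (ℕ → S)
  -- Overwriting coordinate 0 of a countable dense set by points of `D` gives a countable dense set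
  -- whose zeroth coordinates all lie in `D`.
  let upd : (ℕ → S) × S → ℕ → S := fun p ↦ Function.update p.1 0 p.2
  have hupd : Continuous upd := continuous_fst.update 0 continuous_snd
  have hupds : Function.Surjective upd := fun f ↦ ⟨(f, f 0), Function.update_eq_self 0 f⟩
  have hmem : (fun _ ↦ s) ∈ seqClosure (upd '' E ×ˢ D) := by
    rw [hseq _ ((hEc.prod hDc).image _) (hupds.denseRange.dense_image hupd (hE.prod hD))]
    exact mem_univ _
  obtain ⟨f, hf, hlim⟩ := hmem
  refine ⟨fun k ↦ f k 0, fun k ↦ ?_, ((continuous_apply 0).tendsto _).comp hlim⟩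
  obtain ⟨p, hp, hpf⟩ := hf k
  simpa [← hpf, upd] using hp.2

/-- Sequences of continuous functions are continuous functions with values in sequences. -/
def Cp.piHomeomorph (X : Type u) [TopologicalSpace X] (ι : Type*) (Y : Type v)
    [TopologicalSpace Y] : (ι → Cp X Y) ≃ₜ Cp X (ι → Y) where
  toFun f := ⟨fun x i ↦ (f i).1 x, continuous_pi fun i ↦ (f i).2⟩
  invFun g i := ⟨fun x ↦ g.1 x i, (continuous_apply i).comp g.2⟩
  left_inv _ := rfl
  right_inv _ := rfl
  continuous_toFun := by
    refine Continuous.subtype_mk (continuous_pi fun x ↦ continuous_pi fun i ↦ ?_) _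
    exact (continuous_apply x).comp (continuous_subtype_val.comp (continuous_apply i))
  continuous_invFun := by
    refine continuous_pi fun i ↦ Continuous.subtype_mk (continuous_pi fun x ↦ ?_) _
    exact (continuous_apply i).comp ((continuous_apply x).comp continuous_subtype_val)

theorem lindelofSpace_pi_pi {X : Type u} [TopologicalSpace X]
    (hX : ∀ k : ℕ, LindelofSpace (Fin k → X)) (n k : ℕ) : LindelofSpace (Fin k → Fin n → X) := by
  let f : (Fin (k * n) → X) → Fin k → Fin n → X := fun x i j ↦ x (finProdFinEquiv (i, j))
  have hf : Continuous f := by fun_prop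
  have hsurj : Function.Surjective f := fun y ↦
    ⟨fun m ↦ y (finProdFinEquiv.symm m).1 (finProdFinEquiv.symm m).2, by
      funext i j
      simp only [f, Equiv.symm_apply_apply]⟩
  rw [← isLindelof_univ_iff, ← hsurj.range_eq, ← image_univ]
  exact isLindelof_univ.image hf

/-! ### Reduction to the common conjunction -/

section Equivalences

variable {X : Type u} [TopologicalSpace X] [T35Space X]

theorem stronglySequentiallySeparable_Cp_iff (hX : ∀ k : ℕ, LindelofSpace (Fin k → X)) :
    StronglySequentiallySeparable (Cp X ℝ) ↔
      HasInjectionToRealSequences X ∧ GammaSequenceProperty X := by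
  refine ⟨fun h ↦ ⟨separableSpace_Cp_iff.1 h.1, h.gammaSequenceProperty hX⟩, fun ⟨hi, hγ⟩ ↦ ?_⟩
  have := hi.separableSpace
  have := hγ.gammaSelectionProperty.frechetUrysohnSpace ℝ
  exact FrechetUrysohnSpace.stronglySequentiallySeparable

theorem separableSpace_and_frechetUrysohnSpace_Cp_iff
    (hX : ∀ k : ℕ, LindelofSpace (Fin k → X)) :
    TopologicalSpace.SeparableSpace (Cp X ℝ) ∧ FrechetUrysohnSpace (Cp X ℝ) ↔
      HasInjectionToRealSequences X ∧ GammaSequenceProperty X := by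
  refine ⟨fun ⟨_, _⟩ ↦ (stronglySequentiallySeparable_Cp_iff hX).1
    FrechetUrysohnSpace.stronglySequentiallySeparable, fun ⟨hi, hγ⟩ ↦
    ⟨hi.separableSpace, hγ.gammaSelectionProperty.frechetUrysohnSpace ℝ⟩⟩

theorem separableSpace_and_frechetUrysohnSpace_Cp_pi (hi : HasInjectionToRealSequences X)
    (hγ : GammaSequenceProperty X) :
    TopologicalSpace.SeparableSpace (ℕ → Cp X ℝ) ∧ FrechetUrysohnSpace (ℕ → Cp X ℝ) := by
  have := hi.separableSpace
  -- Products need not preserve the Fréchet–Urysohn property, so the power is treated as one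
  -- function space with metrizable target.
  let _ : MetricSpace (ℕ → ℝ) := TopologicalSpace.metrizableSpaceMetric (ℕ → ℝ)
  have := hγ.gammaSelectionProperty.frechetUrysohnSpace (ℕ → ℝ)
  exact ⟨inferInstance, (Cp.piHomeomorph X ℕ ℝ).isInducing.frechetUrysohnSpace⟩

theorem projectiveS1OmegaGamma_iff (hX : ∀ k : ℕ, LindelofSpace (Fin k → X)) :
    ProjectiveS1OmegaGamma X ↔ GammaSequenceProperty X :=
  ⟨fun h ↦ h.gammaSequenceProperty hX, fun h ↦ h.projectiveS1OmegaGamma⟩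

end Equivalences

theorem theorem3p13 (X : Type u) [TopologicalSpace X] [T35Space X]
    (hX : ∀ k : ℕ, LindelofSpace (Fin k → X)) (n : ℕ) (hn : 1 ≤ n) :
    List.TFAE [
      StronglySequentiallySeparable (Cp X ℝ),
      StronglySequentiallySeparable (Cp (Fin n → X) ℝ),
      StronglySequentiallySeparable (ℕ → Cp X ℝ),
      TopologicalSpace.SeparableSpace (Cp X ℝ) ∧ FrechetUrysohnSpace (Cp X ℝ),
      TopologicalSpace.SeparableSpace (Cp (Fin n → X) ℝ) ∧
        FrechetUrysohnSpace (Cp (Fin n → X) ℝ),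
      TopologicalSpace.SeparableSpace (ℕ → Cp X ℝ) ∧ FrechetUrysohnSpace (ℕ → Cp X ℝ),
      iWeight X = ℵ₀ ∧ ProjectiveS1OmegaGamma X,
      iWeight X = ℵ₀ ∧ ProjectiveS1OmegaGamma (Fin n → X),
      iWeight X = ℵ₀ ∧ S1OmegaGamma X,
      iWeight (Fin n → X) = ℵ₀ ∧ S1OmegaGamma (Fin n → X),
      iWeight X = ℵ₀ ∧ GammaProperty X,
      iWeight (Fin n → X) = ℵ₀ ∧ GammaProperty (Fin n → X),
      TopologicalSpace.SeparableSpace (Cp X (ℕ → ℝ)) ∧ FrechetUrysohnSpace (Cp X (ℕ → ℝ)),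
      StronglySequentiallySeparable (Cp X (ℕ → ℝ))] := by
  have hXn := lindelofSpace_pi_pi hX n
  have hP := stronglySequentiallySeparable_Cp_iff hX
  -- Except for 3, 6, 13 and 14, all items become literally the same conjunction.
  simp only [separableSpace_and_frechetUrysohnSpace_Cp_iff hX,
    separableSpace_and_frechetUrysohnSpace_Cp_iff hXn, stronglySequentiallySeparable_Cp_iff hX,
    stronglySequentiallySeparable_Cp_iff hXn, iWeight_eq_aleph0_iff,
    projectiveS1OmegaGamma_iff hX, projectiveS1OmegaGamma_iff hXn,
    s1OmegaGamma_iff_gammaSequenceProperty, gammaProperty_iff_gammaSequenceProperty,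
    hasInjectionToRealSequences_pi_iff hn, gammaSequenceProperty_pi_iff hn]
  let e := Cp.piHomeomorph X ℕ ℝ
  tfae_have 3 → 1 := fun h ↦ hP.1 h.of_pi
  tfae_have 6 → 3 := fun ⟨_, _⟩ ↦ FrechetUrysohnSpace.stronglySequentiallySeparable
  tfae_have 1 → 6 := fun h ↦ separableSpace_and_frechetUrysohnSpace_Cp_pi h.1 h.2
  tfae_have 6 → 13 := fun ⟨_, _⟩ ↦
    ⟨e.surjective.denseRange.separableSpace e.continuous, e.symm.isInducing.frechetUrysohnSpace⟩
  tfae_have 13 → 14 := fun ⟨_, _⟩ ↦ FrechetUrysohnSpace.stronglySequentiallySeparable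
  tfae_have 14 → 3 := fun h ↦ h.of_homeomorph e.symm
  tfae_have 1 ↔ 2 := Iff.rfl
  tfae_have 1 ↔ 4 := Iff.rfl
  tfae_have 1 ↔ 5 := Iff.rfl
  tfae_have 1 ↔ 7 := Iff.rfl
  tfae_have 1 ↔ 8 := Iff.rfl
  tfae_have 1 ↔ 9 := Iff.rfl
  tfae_have 1 ↔ 10 := Iff.rfl
  tfae_have 1 ↔ 11 := Iff.rfl
  tfae_have 1 ↔ 12 := Iff.rfl
  tfae_finish
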